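/- Let $\alpha,\beta,\gamma,\delta$ be real numbers with $\alpha>0$ and $\delta>0$, and assume $$(H)\qquad \max(\beta,\gamma)\ge 0\quad\text{or}\quad \beta\gamma<\alpha\delta .$$ Let $S=\{(x,y)\in\mathbb R^2 : x\ge 0,\ y\ge 0\}$. For every starting point $(x_0,y_0)\in S$ there exists exactly one pair of continuous functions $x,y:[0,\infty)\to[0,\infty)$ such that for every $t\ge 0$ $$\int_0^t \mathbf 1_{\{x(s)=0\}}\,ds=0,\qquad \int_0^t \mathbf 1_{\{y(s)=0\}}\,ds=0,$$ $$\int_0^t \mathbf 1_{\{x(s)>0\}}\frac{ds}{x(s)}<\infty,\qquad \int_0^t \mathbf 1_{\{y(s)>0\}}\frac{ds}{y(s)}<\infty,$$ and $$x(t)=x_0+\alpha\int_0^t\frac{ds}{x(s)}+\beta\int_0^t\frac{ds}{y(s)},\qquad y(t)=y_0+\gamma\int_0^t\frac{ds}{x(s)}+\delta\int_0^t\frac{ds}{y(s)} .$$ -/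

import Mathlib

open MeasureTheory Set

/-- `(x, y)` is a global solution, in the closed nonnegative quadrant, of the integral system
`x(t) = x₀ + α ∫₀ᵗ ds/x(s) + β ∫₀ᵗ ds/y(s)`, `y(t) = y₀ + γ ∫₀ᵗ ds/x(s) + δ ∫₀ᵗ ds/y(s)`, `t ≥ 0`.
Only the values of `x` and `y` on `[0, ∞)` matter. -/
structure IsQuadrantSolution (α β γ δ x₀ y₀ : ℝ) (x y : ℝ → ℝ) : Prop where
  continuousOn_x : ContinuousOn x (Ici 0)
  continuousOn_y : ContinuousOn y (Ici 0)
  nonneg_x : ∀ t, 0 ≤ t → 0 ≤ x t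
  nonneg_y : ∀ t, 0 ≤ t → 0 ≤ y t
  /-- No time is spent on the axes. -/
  zero_time_x : ∀ t, 0 ≤ t → volume {s ∈ Icc 0 t | x s = 0} = 0
  zero_time_y : ∀ t, 0 ≤ t → volume {s ∈ Icc 0 t | y s = 0} = 0
  /-- The reciprocals are integrable on `[0, t]`, off their singularities. -/
  integrable_x : ∀ t, 0 ≤ t → IntegrableOn (fun s => 1 / x s) {s ∈ Icc 0 t | 0 < x s} volume
  integrable_y : ∀ t, 0 ≤ t → IntegrableOn (fun s => 1 / y s) {s ∈ Icc 0 t | 0 < y s} volume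
  eq_x : ∀ t, 0 ≤ t → x t = x₀ + α * (∫ s in 0..t, 1 / x s) + β * (∫ s in 0..t, 1 / y s)
  eq_y : ∀ t, 0 ≤ t → y t = y₀ + γ * (∫ s in 0..t, 1 / x s) + δ * (∫ s in 0..t, 1 / y s)

/-! In the clock `dt = x * y * ds` the system becomes linear, with matrix `[[β, α], [δ, γ]]`. Its
off-diagonal entries are positive, so there is a Perron eigenvector `(u, 1)`, `u > 0`, with
eigenvalue `λ = δ * u + γ`; hypothesis (H) makes `λ > 0` (`exists_invariant_ray`). The other
eigenvalue is `μ = β - δ * u < λ`. The left eigenvectors give the coordinates `p = δ * u * x + α *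
y` and `e = x - u * y`, with `p' = λ * p / (x * y)` and `e' = μ * e / (x * y)`.

Since `p` has positive weights and positive drift, an integral solution is never at the corner at a
positive time; off the corner the singular drift repels it from each axis. So it is classical for `t
> 0` (`IsQuadrantSolution.isClassicalSolution`). Conversely, the growth of `p` bounds the integrals
of `1 / x` and `1 / y`, so classical solutions solve the integral system.

Away from the corner, existence comes from the explicit linear flow and an inverse time change. For
uniqueness, `log p / λ`, normalised to vanish at `0`, recovers the linear clock from any solution
(`eq_flow`). From the corner that clock starts at `-∞`, which forces `e = 0` (`eq_ray_of_corner`);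
on the ray the equation is elementary. -/

/-- A pair of functions on `[0, ∞)`, positive on `(0, ∞)`, that solves
`x' = α / x + β / y`, `y' = γ / x + δ / y` classically on `(0, ∞)`. -/
structure IsClassicalSolution (α β γ δ x₀ y₀ : ℝ) (x y : ℝ → ℝ) : Prop where
  continuousOn_x : ContinuousOn x (Ici 0)
  continuousOn_y : ContinuousOn y (Ici 0)
  initial_x : x 0 = x₀
  initial_y : y 0 = y₀
  pos_x : ∀ t, 0 < t → 0 < x t
  pos_y : ∀ t, 0 < t → 0 < y t
  hasDerivAt_x : ∀ t, 0 < t → HasDerivAt x (α / x t + β / y t) t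
  hasDerivAt_y : ∀ t, 0 < t → HasDerivAt y (γ / x t + δ / y t) t

/-! ### Integral solutions are classical at positive times. -/

namespace IsQuadrantSolution

variable {α β γ δ x₀ y₀ : ℝ} {x y : ℝ → ℝ}

theorem swap (h : IsQuadrantSolution α β γ δ x₀ y₀ x y) :
    IsQuadrantSolution δ γ β α y₀ x₀ y x where
  continuousOn_x := h.continuousOn_y
  continuousOn_y := h.continuousOn_x
  nonneg_x := h.nonneg_y
  nonneg_y := h.nonneg_x
  zero_time_x := h.zero_time_y
  zero_time_y := h.zero_time_x
  integrable_x := h.integrable_y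
  integrable_y := h.integrable_x
  eq_x t ht := by rw [h.eq_y t ht]; ring
  eq_y t ht := by rw [h.eq_x t ht]; ring

theorem intervalIntegrable_x (h : IsQuadrantSolution α β γ δ x₀ y₀ x y) {t : ℝ} (ht : 0 ≤ t) :
    IntervalIntegrable (fun s => 1 / x s) volume 0 t := by
  rw [intervalIntegrable_iff_integrableOn_Icc_of_le ht]
  have hz : IntegrableOn (fun s => 1 / x s) {s ∈ Icc 0 t | x s = 0} volume :=
    IntegrableOn.of_measure_zero (h.zero_time_x t ht)
  refine ((h.integrable_x t ht).union hz).mono_set fun s hs => ?_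
  rcases (h.nonneg_x s hs.1).lt_or_eq with h1 | h1
  · exact Or.inl ⟨hs, h1⟩
  · exact Or.inr ⟨hs, h1.symm⟩

theorem intervalIntegrable_x' (h : IsQuadrantSolution α β γ δ x₀ y₀ x y) {s t : ℝ} (hs : 0 ≤ s)
    (ht : 0 ≤ t) : IntervalIntegrable (fun s => 1 / x s) volume s t :=
  (h.intervalIntegrable_x hs).symm.trans (h.intervalIntegrable_x ht)

theorem sub_eq_x (h : IsQuadrantSolution α β γ δ x₀ y₀ x y) {s t : ℝ} (hs : 0 ≤ s)
    (ht : 0 ≤ t) :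
    x t - x s = ∫ r in s..t, (α * (1 / x r) + β * (1 / y r)) := by
  rw [intervalIntegral.integral_add ((h.intervalIntegrable_x' hs ht).const_mul α)
    ((h.swap.intervalIntegrable_x' hs ht).const_mul β), intervalIntegral.integral_const_mul,
    intervalIntegral.integral_const_mul, h.eq_x t ht, h.eq_x s hs,
    ← intervalIntegral.integral_interval_sub_left (h.intervalIntegrable_x ht)
      (h.intervalIntegrable_x hs),
    ← intervalIntegral.integral_interval_sub_left (h.swap.intervalIntegrable_x ht)
      (h.swap.intervalIntegrable_x hs)]
  ring

theorem not_eqOn_zero_x (h : IsQuadrantSolution α β γ δ x₀ y₀ x y) {s t : ℝ} (hs : 0 ≤ s)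
    (hst : s < t) : ¬ ∀ r ∈ Icc s t, x r = 0 := by
  intro h0
  have hle : volume (Icc s t) ≤ volume {r ∈ Icc 0 t | x r = 0} :=
    measure_mono fun r hr => ⟨⟨hs.trans hr.1, hr.2⟩, h0 r hr⟩
  rw [h.zero_time_x t (hs.trans hst.le), Real.volume_Icc] at hle
  simp at hle
  linarith

/-- A positive linear combination of the coordinates whose drift is positive keeps the solution
away from the corner. -/
theorem pos_of_drift_nonneg (h : IsQuadrantSolution α β γ δ x₀ y₀ x y) {a b : ℝ} (ha : 0 < a)
    (hb : 0 < b) (hx : 0 ≤ a * α + b * γ) (hy : 0 ≤ a * β + b * δ) {t : ℝ} (ht : 0 < t) :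
    0 < x t ∨ 0 < y t := by
  by_contra! hc
  refine h.not_eqOn_zero_x le_rfl ht fun r hr => ?_
  have hx' := h.sub_eq_x hr.1 ht.le
  have hy' := h.swap.sub_eq_x hr.1 ht.le
  have hle : 0 ≤ a * (x t - x r) + b * (y t - y r) := by
    rw [hx', hy', ← intervalIntegral.integral_const_mul, ← intervalIntegral.integral_const_mul,
      ← intervalIntegral.integral_add]
    · refine intervalIntegral.integral_nonneg hr.2 fun q hq => ?_
      have h1 : 0 ≤ 1 / x q := one_div_nonneg.2 (h.nonneg_x q (hr.1.trans hq.1))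
      have h2 : 0 ≤ 1 / y q := one_div_nonneg.2 (h.nonneg_y q (hr.1.trans hq.1))
      have := add_nonneg (mul_nonneg hx h1) (mul_nonneg hy h2)
      linarith
    · exact (((h.intervalIntegrable_x' hr.1 ht.le).const_mul α).add
        ((h.swap.intervalIntegrable_x' hr.1 ht.le).const_mul β)).const_mul a
    · exact (((h.swap.intervalIntegrable_x' hr.1 ht.le).const_mul δ).add
        ((h.intervalIntegrable_x' hr.1 ht.le).const_mul γ)).const_mul b
  have h1 := h.nonneg_x r hr.1
  have h2 := h.nonneg_y r hr.1
  have h3 : a * x t ≤ 0 := mul_nonpos_of_nonneg_of_nonpos ha.le hc.1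
  have h4 : b * y t ≤ 0 := mul_nonpos_of_nonneg_of_nonpos hb.le hc.2
  have h5 : 0 ≤ b * y r := mul_nonneg hb.le h2
  have h6 : a * x r ≤ 0 := by linarith
  exact le_antisymm (nonpos_of_mul_nonpos_right h6 ha) h1

/-- If `x` vanished at `t` with `y t > 0`, then just before `t` the term `α / x` would dominate `β /
y`. So `x` would be nondecreasing there, hence zero on a whole interval, which the zero-time
condition forbids. -/
theorem pos_x_of_pos_y (h : IsQuadrantSolution α β γ δ x₀ y₀ x y) (hα : 0 < α) {t : ℝ}
    (ht : 0 < t) (hy : 0 < y t) : 0 < x t := by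
  by_contra hx
  have hx0 : x t = 0 := le_antisymm (not_lt.1 hx) (h.nonneg_x t ht.le)
  have hcx : ContinuousAt x t := h.continuousOn_x.continuousAt (Ici_mem_nhds ht)
  have hcy : ContinuousAt y t := h.continuousOn_y.continuousAt (Ici_mem_nhds ht)
  have hev : ∀ᶠ s in nhds t, 0 < s ∧ y t / 2 < y s ∧ x s * |β| < α * (y t / 2) := by
    refine (lt_mem_nhds ht).and ((hcy.eventually (lt_mem_nhds (by linarith))).and ?_)
    refine (hcx.mul_const |β|).eventually_lt continuousAt_const ?_
    rw [hx0, zero_mul]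
    positivity
  obtain ⟨ε, hε, hball⟩ := Metric.eventually_nhds_iff.1 hev
  have hnear : ∀ s ∈ Icc (t - ε / 2) t, 0 < s ∧ y t / 2 < y s ∧ x s * |β| < α * (y t / 2) := by
    intro s hs
    apply hball
    rw [Real.dist_eq, abs_lt]
    constructor <;> linarith [hs.1, hs.2]
  have hs0 : 0 < t - ε / 2 := (hnear _ ⟨le_rfl, by linarith⟩).1
  refine h.not_eqOn_zero_x hs0.le (by linarith : t - ε / 2 < t) fun r hr => ?_
  have hr0 : 0 < r := (hnear r hr).1
  have hsub := h.sub_eq_x hr0.le ht.le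
  have hint : 0 ≤ ∫ q in r..t, (α * (1 / x q) + β * (1 / y q)) := by
    refine intervalIntegral.integral_nonneg_of_ae_restrict hr.2 ?_
    -- Zeros of `x` must be discarded: there `1 / x` is `0` by convention, and `β / y` alone may be
    -- negative.
    have hae : ∀ᵐ q, q ∉ {s ∈ Icc 0 t | x s = 0} :=
      measure_eq_zero_iff_ae_notMem.1 (h.zero_time_x t ht.le)
    filter_upwards [ae_restrict_of_ae hae, ae_restrict_mem measurableSet_Icc] with q hq hqm
    obtain ⟨hq0, hyq, hxq⟩ := hnear q ⟨hr.1.trans hqm.1, hqm.2⟩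
    have hxq0 : 0 < x q := lt_of_le_of_ne (h.nonneg_x q hq0.le)
      fun h0 => hq ⟨⟨hq0.le, hqm.2⟩, h0.symm⟩
    have hyq0 : 0 < y q := by linarith
    have : (0 : ℝ) ≤ (α * y q + β * x q) / (x q * y q) := by
      refine div_nonneg ?_ (by positivity)
      have h1 : -|β| * x q ≤ β * x q := mul_le_mul_of_nonneg_right (neg_abs_le β) hxq0.le
      have h2 : α * (y t / 2) ≤ α * y q := mul_le_mul_of_nonneg_left hyq.le hα.le
      linarith
    have he : α * (1 / x q) + β * (1 / y q) = (α * y q + β * x q) / (x q * y q) := by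
      field_simp
    rw [Pi.zero_apply, he]
    exact this
  linarith [h.nonneg_x r hr0.le]

theorem hasDerivAt_x (h : IsQuadrantSolution α β γ δ x₀ y₀ x y) (hx : ∀ t, 0 < t → 0 < x t)
    (hy : ∀ t, 0 < t → 0 < y t) {t : ℝ} (ht : 0 < t) :
    HasDerivAt x (α / x t + β / y t) t := by
  have key : ∀ {α β γ δ x₀ y₀ : ℝ} {x y : ℝ → ℝ}, IsQuadrantSolution α β γ δ x₀ y₀ x y →
      (∀ t, 0 < t → 0 < x t) → HasDerivAt (fun r => ∫ s in 0..r, 1 / x s) (1 / x t) t := by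
    intro α β γ δ x₀ y₀ x y h hx
    have hc : ContinuousOn (fun s => 1 / x s) (Ioi 0) :=
      continuousOn_const.div (h.continuousOn_x.mono Ioi_subset_Ici_self) fun s hs => (hx s hs).ne'
    exact intervalIntegral.integral_hasDerivAt_right (h.intervalIntegrable_x ht.le)
      (hc.stronglyMeasurableAtFilter isOpen_Ioi t ht) (hc.continuousAt (Ioi_mem_nhds ht))
  have hd := (((key h hx).const_mul α).const_add x₀).add ((key h.swap hy).const_mul β)
  rw [show α / x t + β / y t = α * (1 / x t) + β * (1 / y t) by ring]
  refine hd.congr_of_eventuallyEq ?_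
  filter_upwards [lt_mem_nhds ht] with s hs
  exact h.eq_x s hs.le

theorem isClassicalSolution (h : IsQuadrantSolution α β γ δ x₀ y₀ x y) (hα : 0 < α) (hδ : 0 < δ)
    {a b : ℝ} (ha : 0 < a) (hb : 0 < b) (hx : 0 ≤ a * α + b * γ) (hy : 0 ≤ a * β + b * δ) :
    IsClassicalSolution α β γ δ x₀ y₀ x y := by
  have hpos : ∀ t, 0 < t → 0 < x t ∧ 0 < y t := by
    intro t ht
    rcases h.pos_of_drift_nonneg ha hb hx hy ht with h1 | h1
    · exact ⟨h1, h.swap.pos_x_of_pos_y hδ ht h1⟩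
    · exact ⟨h.pos_x_of_pos_y hα ht h1, h1⟩
  have hpx := fun t ht => (hpos t ht).1
  have hpy := fun t ht => (hpos t ht).2
  refine ⟨h.continuousOn_x, h.continuousOn_y, ?_, ?_, hpx, hpy, fun t ht => h.hasDerivAt_x hpx hpy ht,
    fun t ht => ?_⟩
  · simpa using h.eq_x 0 le_rfl
  · simpa using h.eq_y 0 le_rfl
  · rw [add_comm]
    exact h.swap.hasDerivAt_x hpy hpx ht

end IsQuadrantSolution

/-! ### Classical solutions satisfy the integral system. -/

namespace IsClassicalSolution

variable {α β γ δ x₀ y₀ : ℝ} {x y : ℝ → ℝ}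

theorem swap (h : IsClassicalSolution α β γ δ x₀ y₀ x y) :
    IsClassicalSolution δ γ β α y₀ x₀ y x where
  continuousOn_x := h.continuousOn_y
  continuousOn_y := h.continuousOn_x
  initial_x := h.initial_y
  initial_y := h.initial_x
  pos_x := h.pos_y
  pos_y := h.pos_x
  hasDerivAt_x t ht := by rw [add_comm]; exact h.hasDerivAt_y t ht
  hasDerivAt_y t ht := by rw [add_comm]; exact h.hasDerivAt_x t ht

theorem nonneg_x (h : IsClassicalSolution α β γ δ x₀ y₀ x y) (hx₀ : 0 ≤ x₀) {t : ℝ}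
    (ht : 0 ≤ t) : 0 ≤ x t := by
  rcases ht.eq_or_lt with rfl | ht
  · rw [h.initial_x]; exact hx₀
  · exact (h.pos_x t ht).le

theorem zero_time_x (h : IsClassicalSolution α β γ δ x₀ y₀ x y) (t : ℝ) :
    volume {s ∈ Icc 0 t | x s = 0} = 0 := by
  refine measure_mono_null (t := {0}) ?_ (by simp)
  rintro s ⟨hs, h0⟩
  rcases hs.1.eq_or_lt with h1 | h1
  · exact h1.symm
  · exact absurd h0 (h.pos_x s h1).ne'

/-- The function `a * x + b * y` is continuous up to `0` and has nonnegative derivative, so the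
derivative is integrable; it dominates `(a * α + b * γ) / x`. -/
theorem intervalIntegrable_x (h : IsClassicalSolution α β γ δ x₀ y₀ x y) {a b : ℝ}
    (hx : 0 < a * α + b * γ) (hy : 0 ≤ a * β + b * δ) {t : ℝ} (ht : 0 ≤ t) :
    IntervalIntegrable (fun s => 1 / x s) volume 0 t := by
  have hp : IntervalIntegrable
      (fun s => a * (α / x s + β / y s) + b * (γ / x s + δ / y s)) volume 0 t := by
    rw [intervalIntegrable_iff_integrableOn_Ioc_of_le ht]
    refine intervalIntegral.integrableOn_deriv_of_nonneg
      (g := fun s => a * x s + b * y s) ?_ ?_ ?_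
    · exact ((h.continuousOn_x.const_mul a).add (h.continuousOn_y.const_mul b)).mono
        Icc_subset_Ici_self
    · intro s hs
      exact ((h.hasDerivAt_x s hs.1).const_mul a).add ((h.hasDerivAt_y s hs.1).const_mul b)
    · intro s hs
      have h1 := h.pos_x s hs.1
      have h2 := h.pos_y s hs.1
      have : 0 ≤ (a * α + b * γ) / x s + (a * β + b * δ) / y s := by positivity
      convert this using 1
      ring
  refine (hp.const_mul (a * α + b * γ)⁻¹).mono_fun ?_ ?_
  · rw [uIoc_of_le ht]
    refine ContinuousOn.aestronglyMeasurable (continuousOn_const.div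
      (h.continuousOn_x.mono fun s hs => hs.1.le) fun s hs => (h.pos_x s hs.1).ne')
      measurableSet_Ioc
  · rw [uIoc_of_le ht]
    filter_upwards [ae_restrict_mem measurableSet_Ioc] with s hs
    have h1 := h.pos_x s hs.1
    have h2 := h.pos_y s hs.1
    have he : (a * α + b * γ)⁻¹ * (a * (α / x s + β / y s) + b * (γ / x s + δ / y s))
        = 1 / x s + (a * α + b * γ)⁻¹ * ((a * β + b * δ) / y s) := by
      field_simp
      ring
    have h3 : 0 ≤ (a * α + b * γ)⁻¹ * ((a * β + b * δ) / y s) := by positivity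
    have h4 : 0 ≤ 1 / x s := by positivity
    rw [he, Real.norm_of_nonneg h4, Real.norm_of_nonneg (add_nonneg h4 h3)]
    linarith

theorem eq_x (h : IsClassicalSolution α β γ δ x₀ y₀ x y) {t : ℝ} (ht : 0 ≤ t)
    (hx : IntervalIntegrable (fun s => 1 / x s) volume 0 t)
    (hy : IntervalIntegrable (fun s => 1 / y s) volume 0 t) :
    x t = x₀ + α * (∫ s in 0..t, 1 / x s) + β * (∫ s in 0..t, 1 / y s) := by
  have hi := intervalIntegral.integral_eq_sub_of_hasDerivAt_of_le
    (f' := fun s => α * (1 / x s) + β * (1 / y s)) ht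
    (h.continuousOn_x.mono Icc_subset_Ici_self) (fun s hs => by
      rw [mul_one_div, mul_one_div]
      exact h.hasDerivAt_x s hs.1) ((hx.const_mul α).add (hy.const_mul β))
  rw [intervalIntegral.integral_add (hx.const_mul α) (hy.const_mul β),
    intervalIntegral.integral_const_mul, intervalIntegral.integral_const_mul, h.initial_x] at hi
  linarith

theorem isQuadrantSolution (h : IsClassicalSolution α β γ δ x₀ y₀ x y) (hx₀ : 0 ≤ x₀)
    (hy₀ : 0 ≤ y₀) {a b : ℝ} (hx : 0 < a * α + b * γ) (hy : 0 < a * β + b * δ) :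
    IsQuadrantSolution α β γ δ x₀ y₀ x y := by
  have hix : ∀ t, 0 ≤ t → IntervalIntegrable (fun s => 1 / x s) volume 0 t :=
    fun t ht => h.intervalIntegrable_x hx hy.le ht
  have hiy : ∀ t, 0 ≤ t → IntervalIntegrable (fun s => 1 / y s) volume 0 t :=
    fun t ht => h.swap.intervalIntegrable_x (a := b) (b := a) (by linarith) (by linarith) ht
  exact
  { continuousOn_x := h.continuousOn_x
    continuousOn_y := h.continuousOn_y
    nonneg_x := fun t ht => h.nonneg_x hx₀ ht
    nonneg_y := fun t ht => h.swap.nonneg_x hy₀ ht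
    zero_time_x := fun t _ => h.zero_time_x t
    zero_time_y := fun t _ => h.swap.zero_time_x t
    integrable_x := fun t ht => ((intervalIntegrable_iff_integrableOn_Icc_of_le ht).1
      (hix t ht)).mono_set fun s hs => hs.1
    integrable_y := fun t ht => ((intervalIntegrable_iff_integrableOn_Icc_of_le ht).1
      (hiy t ht)).mono_set fun s hs => hs.1
    eq_x := fun t ht => h.eq_x ht (hix t ht) (hiy t ht)
    eq_y := fun t ht => by
      rw [h.swap.eq_x ht (hiy t ht) (hix t ht)]
      ring }

end IsClassicalSolution

/-! ### Existence: Perron eigenvector, linear flow and change of time. -/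

/-- The ray `x = u * y` on which the linearised flow is a pure dilation, with positive rate
`δ * u + γ`. -/
theorem exists_invariant_ray {α β γ δ : ℝ} (hα : 0 < α) (hδ : 0 < δ)
    (H : 0 ≤ max β γ ∨ β * γ < α * δ) :
    ∃ u : ℝ, 0 < u ∧ δ * u ^ 2 + (γ - β) * u = α ∧ 0 < δ * u + γ := by
  set D := (β - γ) ^ 2 + 4 * α * δ with hD
  have hlt : |β - γ| < √D := by
    rw [← Real.sqrt_sq_eq_abs]
    exact Real.sqrt_lt_sqrt (sq_nonneg _) (by rw [hD]; linarith [mul_pos hα hδ])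
  have hsq : √D ^ 2 = D := Real.sq_sqrt (by positivity)
  have hupos : 0 < ((β - γ) + √D) / (2 * δ) :=
    div_pos (by linarith [neg_abs_le (β - γ)]) (by positivity)
  have hueq : δ * (((β - γ) + √D) / (2 * δ)) ^ 2 + (γ - β) * (((β - γ) + √D) / (2 * δ)) = α := by
    field_simp
    linear_combination hsq + hD
  set u := ((β - γ) + √D) / (2 * δ)
  refine ⟨u, hupos, hueq, ?_⟩
  -- This is the other row of the eigenvector equation. If `λ ≤ 0`, the two rows force `β, γ < 0`,
  -- and eliminating `u` between them gives `α * δ ≤ β * γ`, against (H).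
  have hrel : u * (δ * u + γ) = α + β * u := by linear_combination hueq
  by_contra! hle
  have h1 : α + β * u ≤ 0 := hrel ▸ mul_nonpos_of_nonneg_of_nonpos hupos.le hle
  have hβ : β < 0 := by
    by_contra! hβ
    linarith [mul_nonneg hβ hupos.le]
  have hγ : γ < 0 := by linarith [mul_pos hδ hupos]
  rcases H with H | H
  · exact absurd H (not_le.2 (max_lt hβ hγ))
  · have h2 : β * (δ * u + γ) ≥ 0 := mul_nonneg_of_nonpos_of_nonpos hβ.le hle
    have h3 : δ * (α + β * u) ≤ 0 := mul_nonpos_of_nonneg_of_nonpos hδ.le h1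
    linarith

/-- The two sides differ by `(A + B) * exp (mu * s)`. In the application `A + B` is the initial
value of a coordinate, which may be zero. -/
theorem mul_exp_sub_exp_le {A B lam mu s : ℝ} (hAB : 0 ≤ A + B) :
    A * (Real.exp (lam * s) - Real.exp (mu * s)) ≤
      A * Real.exp (lam * s) + B * Real.exp (mu * s) := by
  have := mul_nonneg hAB (Real.exp_pos (mu * s)).le
  linarith

theorem add_exp_pos {A B lam mu s : ℝ} (hA : 0 < A) (hAB : 0 ≤ A + B) (hlt : mu < lam)
    (hs : 0 < s) : 0 < A * Real.exp (lam * s) + B * Real.exp (mu * s) := by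
  refine lt_of_lt_of_le (mul_pos hA (sub_pos.2 (Real.exp_lt_exp.2 ?_))) (mul_exp_sub_exp_le hAB)
  exact mul_lt_mul_of_pos_right hlt hs

/-- A uniform lower bound that makes the new clock run to infinity; `s` stays away from `0` because
a coordinate may start on its axis. -/
theorem le_add_exp {A B lam mu s : ℝ} (hA : 0 < A) (hAB : 0 ≤ A + B) (hlt : mu < lam)
    (hlam : 0 < lam) (hs : 1 ≤ s) :
    A * (1 - Real.exp (mu - lam)) ≤ A * Real.exp (lam * s) + B * Real.exp (mu * s) := by
  refine le_trans (mul_le_mul_of_nonneg_left ?_ hA.le) (mul_exp_sub_exp_le hAB)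
  have h1 : 1 ≤ Real.exp (lam * s) := Real.one_le_exp (by positivity)
  have h2 : Real.exp (mu * s) ≤ Real.exp (lam * s) * Real.exp (mu - lam) := by
    rw [← Real.exp_add]
    refine Real.exp_le_exp.2 ?_
    nlinarith
  have h3 : Real.exp (mu - lam) < 1 := Real.exp_lt_one_iff.2 (by linarith)
  nlinarith

/-- In the time scale `dt = x * y * ds` the system is linear; its solution from a point of the
quadrant other than the corner stays in the open quadrant and away from the axes. -/
theorem exists_linear_flow {α β γ δ u x₀ y₀ : ℝ} (hα : 0 < α) (hδ : 0 < δ) (hu : 0 < u)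
    (hueq : δ * u ^ 2 + (γ - β) * u = α) (hlam : 0 < δ * u + γ) (hx₀ : 0 ≤ x₀) (hy₀ : 0 ≤ y₀)
    (hp : 0 < δ * u * x₀ + α * y₀) :
    ∃ X Y : ℝ → ℝ, X 0 = x₀ ∧ Y 0 = y₀ ∧
      (∀ s, δ * u * X s + α * Y s = (δ * u * x₀ + α * y₀) * Real.exp ((δ * u + γ) * s)) ∧
      (∀ s, X s - u * Y s = (x₀ - u * y₀) * Real.exp ((β - δ * u) * s)) ∧
      (∀ s, HasDerivAt X (β * X s + α * Y s) s) ∧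
      (∀ s, HasDerivAt Y (δ * X s + γ * Y s) s) ∧
      (∀ s, 0 < s → 0 < X s) ∧ (∀ s, 0 < s → 0 < Y s) ∧
      ∃ c, 0 < c ∧ ∀ s, 1 ≤ s → c ≤ X s * Y s := by
  set N := δ * u ^ 2 + α with hN
  have hNpos : 0 < N := by positivity
  set p := δ * u * x₀ + α * y₀ with hpdef
  set e := x₀ - u * y₀ with hedef
  set lam := δ * u + γ with hlamdef
  set mu := β - δ * u with hmudef
  have hlt : mu < lam := by
    have : u * (lam - mu) = N := by rw [hlamdef, hmudef, hN]; linear_combination hueq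
    have : 0 < lam - mu := by
      by_contra! hc
      linarith [mul_nonpos_of_nonneg_of_nonpos hu.le hc]
    linarith
  have hexp : ∀ k s : ℝ, HasDerivAt (fun s => Real.exp (k * s)) (Real.exp (k * s) * k) s := by
    intro k s
    simpa using ((hasDerivAt_id s).const_mul k).exp
  -- The starting point splits as `(p / N) • (u, 1) + (e / N) • (α, -δ * u)`, along the eigenvectors
  -- for `lam` and `mu`.
  have hA₁ : 0 < u * p / N := by positivity
  have hA₂ : 0 < p / N := by positivity
  have hs₁ : u * p / N + α * e / N = x₀ := by
    rw [← add_div, div_eq_iff hNpos.ne', hpdef, hedef, hN]; ring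
  have hs₂ : p / N + -(δ * u * e) / N = y₀ := by
    rw [← add_div, div_eq_iff hNpos.ne', hpdef, hedef, hN]; ring
  refine ⟨fun s => u * p / N * Real.exp (lam * s) + α * e / N * Real.exp (mu * s),
    fun s => p / N * Real.exp (lam * s) + -(δ * u * e) / N * Real.exp (mu * s),
    by simpa using hs₁, by simpa using hs₂, fun s => ?_, fun s => ?_, fun s => ?_, fun s => ?_,
    fun s hs => add_exp_pos hA₁ (hs₁ ▸ hx₀) hlt hs, fun s hs => add_exp_pos hA₂ (hs₂ ▸ hy₀) hlt hs,
    u * p / N * (1 - Real.exp (mu - lam)) * (p / N * (1 - Real.exp (mu - lam))), ?_, fun s hs => ?_⟩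
  · field_simp
    rw [hN]; ring
  · field_simp
    rw [hN]; ring
  · refine (((hexp lam s).const_mul (u * p / N)).add
      ((hexp mu s).const_mul (α * e / N))).congr_deriv ?_
    have h1 : β * u + α = u * lam := by rw [hlamdef]; linear_combination -hueq
    linear_combination -(p / N * Real.exp (lam * s)) * h1
  · refine (((hexp lam s).const_mul (p / N)).add
      ((hexp mu s).const_mul (-(δ * u * e) / N))).congr_deriv ?_
    have h1 : α - γ * u = -u * mu := by rw [hmudef]; linear_combination -hueq
    linear_combination -(δ * e / N * Real.exp (mu * s)) * h1
  · have h3 : Real.exp (mu - lam) < 1 := Real.exp_lt_one_iff.2 (by linarith)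
    have h4 : 0 < 1 - Real.exp (mu - lam) := by linarith
    positivity
  · have h3 : Real.exp (mu - lam) < 1 := Real.exp_lt_one_iff.2 (by linarith)
    have h4 : 0 < 1 - Real.exp (mu - lam) := by linarith
    have h5 := le_add_exp hA₁ (hs₁ ▸ hx₀) hlt hlam hs
    have h6 := le_add_exp hA₂ (hs₂ ▸ hy₀) hlt hlam hs
    exact mul_le_mul h5 h6 (by positivity) ((by positivity : (0 : ℝ) ≤ _).trans h5)

/-- A continuous rate that is positive on `(0, ∞)` and bounded below near infinity defines
a change of time. -/
theorem exists_time_change {g : ℝ → ℝ} (hg : Continuous g) (hpos : ∀ s, 0 < s → 0 < g s) {c : ℝ}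
    (hc : 0 < c) (hlow : ∀ s, 1 ≤ s → c ≤ g s) :
    ∃ T : ℝ ≃o ℝ, T 0 = 0 ∧ ∀ s, 0 < s → HasDerivAt T (g s) s := by
  -- Nothing is known about `g` on the negative axis; reflecting it makes the primitive `F` odd,
  -- hence a bijection of `ℝ`.
  have hga : Continuous fun s => g |s| := hg.comp continuous_abs
  set F : ℝ → ℝ := fun s => ∫ r in 0..s, g |r| with hF
  have hd : ∀ s, HasDerivAt F (g |s|) s := fun s => hga.integral_hasStrictDerivAt 0 s |>.hasDerivAt
  have hcont : Continuous F := continuous_iff_continuousAt.2 fun s => (hd s).continuousAt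
  have hderiv : ∀ s, s ≠ 0 → 0 < deriv F s := fun s hs => by
    rw [(hd s).deriv]
    exact hpos _ (abs_pos.2 hs)
  -- The rate may vanish at `0`, so the two half-lines are treated separately and glued.
  have hmono : StrictMono F := by
    refine StrictMonoOn.Iic_union_Ici (a := 0) ?_ ?_
    · refine strictMonoOn_of_deriv_pos (convex_Iic 0) hcont.continuousOn fun s hs => hderiv s ?_
      rw [interior_Iic] at hs
      exact ne_of_lt hs
    · refine strictMonoOn_of_deriv_pos (convex_Ici 0) hcont.continuousOn fun s hs => hderiv s ?_
      rw [interior_Ici] at hs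
      exact ne_of_gt hs
  have hodd : ∀ s, F (-s) = -F s := by
    intro s
    have h1 := intervalIntegral.integral_comp_neg (a := 0) (b := s) fun r => g |r|
    simp only [abs_neg, neg_zero] at h1
    rw [hF]
    simp only
    rw [h1, intervalIntegral.integral_symm]
  have hF0 : F 0 = 0 := by simp [hF]
  have hgrow : ∀ s, 1 ≤ s → c * (s - 1) ≤ F s := by
    intro s hs
    have h1 : F s - F 1 = ∫ r in (1 : ℝ)..s, g |r| :=
      intervalIntegral.integral_interval_sub_left (hga.intervalIntegrable _ _)
        (hga.intervalIntegrable _ _)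
    have h2 : ∫ _ in (1 : ℝ)..s, c ≤ ∫ r in (1 : ℝ)..s, g |r| := by
      refine intervalIntegral.integral_mono_on hs (by simp) (hga.intervalIntegrable _ _) ?_
      intro r hr
      exact hlow _ (hr.1.trans (le_abs_self r))
    have h3 : F 0 < F 1 := hmono one_pos
    simp only [intervalIntegral.integral_const, smul_eq_mul] at h2
    linarith
  have htop : Filter.Tendsto F Filter.atTop Filter.atTop := by
    refine Filter.tendsto_atTop_mono' _ ((Filter.eventually_ge_atTop 1).mono hgrow) ?_
    exact (Filter.tendsto_atTop_add_const_right _ (-1) Filter.tendsto_id).const_mul_atTop hc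
  have hbot : Filter.Tendsto F Filter.atBot Filter.atBot := by
    have h1 := Filter.tendsto_neg_atTop_atBot.comp (htop.comp Filter.tendsto_neg_atBot_atTop)
    refine h1.congr fun s => ?_
    simp [hodd]
  refine ⟨hmono.orderIsoOfSurjective F (hcont.surjective htop hbot), hF0, fun s hs => ?_⟩
  have h1 := hd s
  rw [abs_of_pos hs] at h1
  exact h1

/-- The time-changed linear flow is a classical solution. -/
theorem isClassicalSolution_of_flow {α β γ δ : ℝ} {X Y : ℝ → ℝ} {T : ℝ ≃o ℝ}
    (hX : ∀ s, HasDerivAt X (β * X s + α * Y s) s) (hY : ∀ s, HasDerivAt Y (δ * X s + γ * Y s) s)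
    (hXpos : ∀ s, 0 < s → 0 < X s) (hYpos : ∀ s, 0 < s → 0 < Y s) (hT0 : T 0 = 0)
    (hT : ∀ s, 0 < s → HasDerivAt T (X s * Y s) s) :
    IsClassicalSolution α β γ δ (X 0) (Y 0) (fun t => X (T.symm t)) (fun t => Y (T.symm t)) := by
  have hS0 : T.symm 0 = 0 := by rw [OrderIso.symm_apply_eq, hT0]
  have hSc : Continuous T.symm := T.symm.continuous
  have hSpos : ∀ t, 0 < t → 0 < T.symm t := fun t ht => by
    rw [← hS0]
    exact T.symm.strictMono ht
  have hXc : Continuous X := continuous_iff_continuousAt.2 fun s => (hX s).continuousAt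
  have hYc : Continuous Y := continuous_iff_continuousAt.2 fun s => (hY s).continuousAt
  have hS : ∀ t, 0 < t → HasDerivAt T.symm (X (T.symm t) * Y (T.symm t))⁻¹ t := fun t ht =>
    HasDerivAt.of_local_left_inverse hSc.continuousAt (hT _ (hSpos t ht))
      (mul_pos (hXpos _ (hSpos t ht)) (hYpos _ (hSpos t ht))).ne'
      (Filter.Eventually.of_forall fun s => T.apply_symm_apply s)
  refine ⟨(hXc.comp hSc).continuousOn, (hYc.comp hSc).continuousOn, by simp [hS0], by simp [hS0],
    fun t ht => hXpos _ (hSpos t ht), fun t ht => hYpos _ (hSpos t ht), fun t ht => ?_,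
    fun t ht => ?_⟩
  · have h1 := (hXpos _ (hSpos t ht)).ne'
    have h2 := (hYpos _ (hSpos t ht)).ne'
    refine ((hX (T.symm t)).comp t (hS t ht)).congr_deriv ?_
    field_simp
    ring
  · have h1 := (hXpos _ (hSpos t ht)).ne'
    have h2 := (hYpos _ (hSpos t ht)).ne'
    refine ((hY (T.symm t)).comp t (hS t ht)).congr_deriv ?_
    field_simp
    ring

/-- The self-similar solution from the corner. -/
theorem isClassicalSolution_selfSimilar {α β γ δ u : ℝ} (hu : 0 < u)
    (hueq : δ * u ^ 2 + (γ - β) * u = α) (hlam : 0 < δ * u + γ) :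
    IsClassicalSolution α β γ δ 0 0 (fun t => u * √(2 * (δ * u + γ) / u * t))
      (fun t => √(2 * (δ * u + γ) / u * t)) := by
  -- On the ray `x = u * y` the second equation reads `y' = (δ * u + γ) / (u * y)`, so `y ^ 2` has
  -- slope `k`.
  set k := 2 * (δ * u + γ) / u with hk
  have hkpos : 0 < k := by positivity
  have hd : ∀ t, 0 < t → HasDerivAt (fun t => √(k * t)) (k / (2 * √(k * t))) t := by
    intro t ht
    simpa using ((hasDerivAt_id t).const_mul k).sqrt (by simp; constructor <;> positivity)
  have hpos : ∀ t, 0 < t → 0 < √(k * t) := fun t ht => Real.sqrt_pos.2 (by positivity)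
  refine ⟨by fun_prop, by fun_prop, by simp, by simp, fun t ht => mul_pos hu (hpos t ht), hpos,
    fun t ht => ?_, fun t ht => ?_⟩
  · have h1 := (hpos t ht).ne'
    refine ((hd t ht).const_mul u).congr_deriv ?_
    generalize √(k * t) = r at h1 ⊢
    rw [hk]
    field_simp
    linear_combination hueq
  · have h1 := (hpos t ht).ne'
    refine (hd t ht).congr_deriv ?_
    generalize √(k * t) = r at h1 ⊢
    rw [hk]
    field_simp
    ring

/-! ### Uniqueness of classical solutions. -/

theorem eq_add_mul_of_hasDerivAt_const {f : ℝ → ℝ} {k a b : ℝ} (hab : a ≤ b)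
    (hc : ContinuousOn f (Icc a b)) (hd : ∀ t ∈ Ioo a b, HasDerivAt f k t) :
    f b = f a + k * (b - a) := by
  rcases hab.eq_or_lt with rfl | hlt
  · simp
  obtain ⟨c, -, hcs⟩ := exists_hasDerivAt_eq_slope f (fun _ => k) hlt hc hd
  rw [eq_div_iff (sub_pos.2 hlt).ne'] at hcs
  linarith

namespace IsClassicalSolution

variable {α β γ δ u x₀ y₀ : ℝ} {x y : ℝ → ℝ}

/-- `(δ * u, α)` is a left eigenvector of the linearised system for `λ`. -/
theorem hasDerivAt_expanding (h : IsClassicalSolution α β γ δ x₀ y₀ x y)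
    (hueq : δ * u ^ 2 + (γ - β) * u = α) {t : ℝ} (ht : 0 < t) :
    HasDerivAt (fun t => δ * u * x t + α * y t)
      ((δ * u + γ) * (δ * u * x t + α * y t) * (x t * y t)⁻¹) t := by
  have h1 := (h.pos_x t ht).ne'
  have h2 := (h.pos_y t ht).ne'
  refine (((h.hasDerivAt_x t ht).const_mul (δ * u)).add
    ((h.hasDerivAt_y t ht).const_mul α)).congr_deriv ?_
  field_simp
  linear_combination -(δ * x t) * hueq

/-- `(1, -u)` is a left eigenvector for `μ = β - δ * u`. -/
theorem hasDerivAt_transverse (h : IsClassicalSolution α β γ δ x₀ y₀ x y)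
    (hueq : δ * u ^ 2 + (γ - β) * u = α) {t : ℝ} (ht : 0 < t) :
    HasDerivAt (fun t => x t - u * y t) ((β - δ * u) * (x t - u * y t) * (x t * y t)⁻¹) t := by
  have h1 := (h.pos_x t ht).ne'
  have h2 := (h.pos_y t ht).ne'
  refine ((h.hasDerivAt_x t ht).sub ((h.hasDerivAt_y t ht).const_mul u)).congr_deriv ?_
  field_simp
  linear_combination -(y t) * hueq

theorem expanding_pos (h : IsClassicalSolution α β γ δ x₀ y₀ x y) (hα : 0 < α) (hδ : 0 < δ)
    (hu : 0 < u) {t : ℝ} (ht : 0 < t) : 0 < δ * u * x t + α * y t := by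
  have h1 := h.pos_x t ht
  have h2 := h.pos_y t ht
  positivity

/-- The logarithm of the expanding coordinate, suitably normalised, is the time scale in which
the system is linear. -/
theorem hasDerivAt_logTime (h : IsClassicalSolution α β γ δ x₀ y₀ x y) (hα : 0 < α) (hδ : 0 < δ)
    (hu : 0 < u) (hueq : δ * u ^ 2 + (γ - β) * u = α) (hlam : 0 < δ * u + γ) (c : ℝ) {t : ℝ}
    (ht : 0 < t) :
    HasDerivAt (fun t => (Real.log (δ * u * x t + α * y t) - c) / (δ * u + γ))
      (x t * y t)⁻¹ t := by
  have hp := (h.expanding_pos hα hδ hu ht).ne'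
  refine ((((h.hasDerivAt_expanding hueq ht).log hp).sub_const c).div_const _).congr_deriv ?_
  field_simp

theorem hasDerivAt_invariant (h : IsClassicalSolution α β γ δ x₀ y₀ x y)
    (hueq : δ * u ^ 2 + (γ - β) * u = α) {τ : ℝ → ℝ} {t : ℝ} (ht : 0 < t)
    (hτ : HasDerivAt τ (x t * y t)⁻¹ t) :
    HasDerivAt (fun t => (x t - u * y t) * Real.exp (-((β - δ * u) * τ t))) 0 t := by
  refine ((h.hasDerivAt_transverse hueq ht).mul
    ((hτ.const_mul (β - δ * u)).neg.exp)).congr_deriv ?_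
  ring

/-- The clock `τ = log (p / p₀) / λ` is read off the solution itself. In it `p` and `e` are the
exponentials of the linear flow, so `(x, y) = (X, Y) ∘ τ`. Then `T ∘ τ` has derivative `1`, which
identifies `τ` with the inverse of `T`. No Lipschitz bound is needed, so starting points on an axis
are covered. -/
theorem eq_flow (h : IsClassicalSolution α β γ δ x₀ y₀ x y) (hα : 0 < α) (hδ : 0 < δ)
    (hu : 0 < u) (hueq : δ * u ^ 2 + (γ - β) * u = α) (hlam : 0 < δ * u + γ)
    (hp : 0 < δ * u * x₀ + α * y₀) {X Y : ℝ → ℝ} {T : ℝ ≃o ℝ}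
    (hP : ∀ s, δ * u * X s + α * Y s = (δ * u * x₀ + α * y₀) * Real.exp ((δ * u + γ) * s))
    (hE : ∀ s, X s - u * Y s = (x₀ - u * y₀) * Real.exp ((β - δ * u) * s))
    (hT0 : T 0 = 0) (hT : ∀ s, 0 < s → HasDerivAt T (X s * Y s) s) {t : ℝ} (ht : 0 ≤ t) :
    x t = X (T.symm t) ∧ y t = Y (T.symm t) := by
  set p₀ := δ * u * x₀ + α * y₀ with hp₀
  set τ : ℝ → ℝ := fun t => (Real.log (δ * u * x t + α * y t) - Real.log p₀) / (δ * u + γ) with hτ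
  have hppos : ∀ s, 0 ≤ s → 0 < δ * u * x s + α * y s := by
    intro s hs
    rcases hs.eq_or_lt with rfl | hs
    · rw [h.initial_x, h.initial_y]; exact hp
    · exact h.expanding_pos hα hδ hu hs
  have hτd : ∀ s, 0 < s → HasDerivAt τ (x s * y s)⁻¹ s := fun s hs =>
    h.hasDerivAt_logTime hα hδ hu hueq hlam _ hs
  have hτc : ContinuousOn τ (Ici 0) := by
    refine ((ContinuousOn.log ?_ fun s hs => (hppos s hs).ne').sub continuousOn_const).div_const _
    exact (h.continuousOn_x.const_mul _).add (h.continuousOn_y.const_mul _)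
  have hτ0 : τ 0 = 0 := by simp [hτ, h.initial_x, h.initial_y, ← hp₀]
  have hτpos : ∀ s, 0 < s → 0 < τ s := by
    intro s hs
    rw [← hτ0]
    refine strictMonoOn_of_deriv_pos (convex_Ici 0) hτc (fun r hr => ?_) self_mem_Ici hs.le hs
    rw [interior_Ici] at hr
    rw [(hτd r hr).deriv]
    exact inv_pos.2 (mul_pos (h.pos_x r hr) (h.pos_y r hr))
  have hpτ : ∀ s, 0 ≤ s → δ * u * x s + α * y s = p₀ * Real.exp ((δ * u + γ) * τ s) := by
    intro s hs
    have : (δ * u + γ) * τ s = Real.log (δ * u * x s + α * y s) - Real.log p₀ := by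
      rw [hτ]; field_simp
    rw [this, Real.exp_sub, Real.exp_log (hppos s hs), Real.exp_log hp]
    field_simp
  have heτ : ∀ s, 0 ≤ s → x s - u * y s = (x₀ - u * y₀) * Real.exp ((β - δ * u) * τ s) := by
    intro s hs
    have hconst := eq_add_mul_of_hasDerivAt_const hs
      (f := fun t => (x t - u * y t) * Real.exp (-((β - δ * u) * τ t)))
      (((h.continuousOn_x.sub (h.continuousOn_y.const_mul u)).mul
        (hτc.const_mul _).neg.rexp).mono Icc_subset_Ici_self)
      fun r hr => h.hasDerivAt_invariant hueq hr.1 (hτd r hr.1)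
    simp only [hτ0, h.initial_x, h.initial_y, mul_zero, neg_zero, Real.exp_zero, mul_one,
      zero_mul, add_zero] at hconst
    rw [← hconst, mul_assoc, ← Real.exp_add]
    simp
  have hxy : ∀ s, 0 ≤ s → x s = X (τ s) ∧ y s = Y (τ s) := by
    intro s hs
    have h1 := (hpτ s hs).trans (hP (τ s)).symm
    have h2 := (heτ s hs).trans (hE (τ s)).symm
    -- Up to sign, the determinant of the change of coordinates from `(x, y)` to `(p, e)`.
    have hN : δ * u ^ 2 + α ≠ 0 := by positivity
    constructor
    · refine mul_left_cancel₀ hN ?_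
      linear_combination u * h1 + α * h2
    · refine mul_left_cancel₀ hN ?_
      linear_combination h1 - δ * u * h2
  have hTτ : T (τ t) = t := by
    have hlin := eq_add_mul_of_hasDerivAt_const (f := fun s => T (τ s)) (k := 1) ht
      ((T.continuous.comp_continuousOn hτc).mono Icc_subset_Ici_self) fun r hr => by
        have h1 := (h.pos_x r hr.1).ne'
        have h2 := (h.pos_y r hr.1).ne'
        refine ((hT _ (hτpos r hr.1)).comp r (hτd r hr.1)).congr_deriv ?_
        rw [← (hxy r hr.1.le).1, ← (hxy r hr.1.le).2]
        field_simp
    simpa [hτ0, hT0] using hlin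
  have hs : T.symm t = τ t := by rw [OrderIso.symm_apply_eq, hTτ]
  rw [hs]
  exact hxy t ht

/-- A solution from the corner stays on the invariant ray. -/
theorem eq_ray_of_corner (h : IsClassicalSolution α β γ δ 0 0 x y) (hα : 0 < α) (hδ : 0 < δ)
    (hu : 0 < u) (hueq : δ * u ^ 2 + (γ - β) * u = α) (hlam : 0 < δ * u + γ) {t : ℝ}
    (ht : 0 < t) : x t = u * y t := by
  set p : ℝ → ℝ := fun t => δ * u * x t + α * y t with hp
  -- Here `p 0 = 0`, so the clock cannot be normalised at time `0`; it tends to `-∞` there.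
  set τ : ℝ → ℝ := fun t => (Real.log (p t) - 0) / (δ * u + γ) with hτ
  have hτd : ∀ s, 0 < s → HasDerivAt τ (x s * y s)⁻¹ s := fun s hs =>
    h.hasDerivAt_logTime hα hδ hu hueq hlam 0 hs
  set f : ℝ → ℝ := fun t => (x t - u * y t) * Real.exp (-((β - δ * u) * τ t)) with hf
  have hfd : ∀ s, 0 < s → HasDerivAt f 0 s := fun s hs => h.hasDerivAt_invariant hueq hs (hτd s hs)
  have hgap : 0 < (δ * u + γ) - (β - δ * u) := by
    have : u * ((δ * u + γ) - (β - δ * u)) = δ * u ^ 2 + α := by linear_combination hueq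
    exact pos_of_mul_pos_right (this ▸ by positivity) hu.le
  -- Chosen so that `|e| ≤ x + u * y ≤ K * p`. As `p = exp (λ * τ)`, the constant `f = e * exp (-μ *
  -- τ)` is at most `K * exp ((λ - μ) * τ)` in absolute value, which tends to `0` at the corner.
  set K := 1 / (δ * u) + u / α with hK
  have hbound : ∀ s, 0 < s → s ≤ t →
      |f t| ≤ K * Real.exp (((δ * u + γ) - (β - δ * u)) * τ s) := by
    intro s hs hst
    have hconst := eq_add_mul_of_hasDerivAt_const hst
      (fun r hr => (hfd r (hs.trans_le hr.1)).continuousAt.continuousWithinAt)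
      fun r hr => hfd r (hs.trans hr.1)
    have hxs := h.pos_x s hs
    have hys := h.pos_y s hs
    have hps : Real.exp ((δ * u + γ) * τ s) = p s := by
      have : (δ * u + γ) * τ s = Real.log (p s) := by rw [hτ]; field_simp; ring
      rw [this, Real.exp_log (h.expanding_pos hα hδ hu hs)]
    have he : |x s - u * y s| ≤ K * p s := by
      have h1 : K * p s = x s + u * y s + (α * y s / (δ * u) + u * (δ * u * x s) / α) := by
        rw [hK, hp]; field_simp; ring
      have h2 : 0 ≤ α * y s / (δ * u) + u * (δ * u * x s) / α := by positivity
      have h3 : 0 < u * y s := by positivity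
      rw [abs_le]
      constructor <;> linarith
    rw [hconst, zero_mul, add_zero, hf]
    simp only
    rw [abs_mul, Real.abs_exp, show ((δ * u + γ) - (β - δ * u)) * τ s =
      (δ * u + γ) * τ s + -((β - δ * u) * τ s) by ring, Real.exp_add, hps, ← mul_assoc]
    exact mul_le_mul_of_nonneg_right he (Real.exp_pos _).le
  have hlim : Filter.Tendsto (fun s => K * Real.exp (((δ * u + γ) - (β - δ * u)) * τ s))
      (nhdsWithin 0 (Ioi 0)) (nhds 0) := by
    have hpc : ContinuousOn p (Ici 0) :=
      (h.continuousOn_x.const_mul _).add (h.continuousOn_y.const_mul _)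
    have hp0 : p 0 = 0 := by simp [hp, h.initial_x, h.initial_y]
    have h1 : Filter.Tendsto p (nhdsWithin 0 (Ioi 0)) (nhdsWithin 0 (Ioi 0)) := by
      refine tendsto_nhdsWithin_iff.2 ⟨?_, ?_⟩
      · have := (hpc 0 self_mem_Ici).mono Ioi_subset_Ici_self
        rwa [ContinuousWithinAt, hp0] at this
      · filter_upwards [self_mem_nhdsWithin] with s hs
        exact h.expanding_pos hα hδ hu hs
    have h2 : Filter.Tendsto τ (nhdsWithin 0 (Ioi 0)) Filter.atBot := by
      have := (Real.tendsto_log_nhdsGT_zero.comp h1).atBot_div_const hlam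
      simpa [hτ] using this
    have h3 := (Real.tendsto_exp_atBot.comp (h2.const_mul_atBot hgap)).const_mul K
    simpa using h3
  have hf0 : |f t| ≤ 0 := by
    refine ge_of_tendsto hlim ?_
    filter_upwards [Ioc_mem_nhdsGT ht] with s hs
    exact hbound s hs.1 hs.2
  have hft : f t = 0 := abs_nonpos_iff.1 hf0
  have := (mul_eq_zero.1 hft).resolve_right (Real.exp_pos _).ne'
  linarith

theorem eq_selfSimilar (h : IsClassicalSolution α β γ δ 0 0 x y) (hα : 0 < α) (hδ : 0 < δ)
    (hu : 0 < u) (hueq : δ * u ^ 2 + (γ - β) * u = α) (hlam : 0 < δ * u + γ) {t : ℝ}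
    (ht : 0 ≤ t) :
    x t = u * √(2 * (δ * u + γ) / u * t) ∧ y t = √(2 * (δ * u + γ) / u * t) := by
  have hy : y t = √(2 * (δ * u + γ) / u * t) := by
    have hlin := eq_add_mul_of_hasDerivAt_const (f := fun s => y s ^ 2)
      (k := 2 * (δ * u + γ) / u) ht
      ((h.continuousOn_y.pow 2).mono Icc_subset_Ici_self) fun r hr => by
        have h1 := (h.pos_y r hr.1).ne'
        refine ((h.hasDerivAt_y r hr.1).pow 2).congr_deriv ?_
        rw [h.eq_ray_of_corner hα hδ hu hueq hlam hr.1]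
        field_simp
        ring
    simp only [h.initial_y, sub_zero, ne_eq, OfNat.ofNat_ne_zero, not_false_eq_true, zero_pow,
      zero_add] at hlin
    rw [← hlin, Real.sqrt_sq (h.swap.nonneg_x le_rfl ht)]
  refine ⟨?_, hy⟩
  rw [← hy]
  rcases ht.eq_or_lt with rfl | ht
  · rw [h.initial_x, h.initial_y, mul_zero]
  · exact h.eq_ray_of_corner hα hδ hu hueq hlam ht

end IsClassicalSolution

theorem mainTheorem1 (α β γ δ : ℝ) (hα : 0 < α) (hδ : 0 < δ)
    (H : 0 ≤ max β γ ∨ β * γ < α * δ) (x₀ y₀ : ℝ) (hx₀ : 0 ≤ x₀) (hy₀ : 0 ≤ y₀) :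
    (∃ x y : ℝ → ℝ, IsQuadrantSolution α β γ δ x₀ y₀ x y) ∧
    ∀ x y x' y' : ℝ → ℝ, IsQuadrantSolution α β γ δ x₀ y₀ x y →
      IsQuadrantSolution α β γ δ x₀ y₀ x' y' → ∀ t, 0 ≤ t → x t = x' t ∧ y t = y' t := by
  obtain ⟨u, hu, hueq, hlam⟩ := exists_invariant_ray hα hδ H
  have ha : 0 < δ * u := by positivity
  -- With the left Perron vector as weights, the drift coefficients are `α * λ` and `δ * u * λ`,
  -- both positive.
  have hdx : 0 < δ * u * α + α * γ := by
    rw [show δ * u * α + α * γ = α * (δ * u + γ) by ring]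
    positivity
  have hdy : 0 < δ * u * β + α * δ := by
    rw [show δ * u * β + α * δ = δ * u * (δ * u + γ) by linear_combination -δ * hueq]
    positivity
  suffices hs : ∃ X Y : ℝ → ℝ, IsClassicalSolution α β γ δ x₀ y₀ X Y ∧
      ∀ x y : ℝ → ℝ, IsClassicalSolution α β γ δ x₀ y₀ x y →
        ∀ t, 0 ≤ t → x t = X t ∧ y t = Y t by
    obtain ⟨X, Y, hsol, huniq⟩ := hs
    refine ⟨⟨X, Y, hsol.isQuadrantSolution hx₀ hy₀ hdx hdy⟩, ?_⟩
    intro x y x' y' h h' t ht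
    have h1 := huniq x y (h.isClassicalSolution hα hδ ha hα hdx.le hdy.le) t ht
    have h2 := huniq x' y' (h'.isClassicalSolution hα hδ ha hα hdx.le hdy.le) t ht
    exact ⟨h1.1.trans h2.1.symm, h1.2.trans h2.2.symm⟩
  have hnn : 0 ≤ δ * u * x₀ + α * y₀ := by positivity
  -- The expanding coordinate vanishes initially only at the corner.
  rcases hnn.eq_or_lt with hp | hp
  · have h1 : 0 ≤ δ * u * x₀ := by positivity
    have h2 : 0 ≤ α * y₀ := by positivity
    obtain rfl : x₀ = 0 := (mul_eq_zero.1 (by linarith : δ * u * x₀ = 0)).resolve_left ha.ne'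
    obtain rfl : y₀ = 0 := (mul_eq_zero.1 (by linarith : α * y₀ = 0)).resolve_left hα.ne'
    exact ⟨_, _, isClassicalSolution_selfSimilar hu hueq hlam,
      fun x y h t ht => h.eq_selfSimilar hα hδ hu hueq hlam ht⟩
  · obtain ⟨X, Y, hX0, hY0, hP, hE, hX, hY, hXpos, hYpos, c, hc, hlow⟩ :=
      exists_linear_flow hα hδ hu hueq hlam hx₀ hy₀ hp
    have hcont : Continuous fun s => X s * Y s :=
      (continuous_iff_continuousAt.2 fun s => (hX s).continuousAt).mul
        (continuous_iff_continuousAt.2 fun s => (hY s).continuousAt)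
    obtain ⟨T, hT0, hT⟩ := exists_time_change hcont
      (fun s hs => mul_pos (hXpos s hs) (hYpos s hs)) hc hlow
    have hsol := isClassicalSolution_of_flow hX hY hXpos hYpos hT0 hT
    rw [hX0, hY0] at hsol
    exact ⟨_, _, hsol, fun x y h t ht => h.eq_flow hα hδ hu hueq hlam hp hP hE hT0 hT ht⟩
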